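/- Let $H$ be a complex Hilbert space, $G$ a group and $\pi$ a bounded representation of $G$ on $H$, that is, a homomorphism from $G$ into the invertible bounded linear operators on $H$ with $\|\pi\| := \sup_{g\in G}\|\pi(g)\| < \infty$. For an invertible self-adjoint bounded operator $A$ on $H$ put $\Phi_A(x) = (Ax,x)$; the number of negative squares of $\Phi_A$ is the dimension of the spectral subspace of $A$ for $(-\infty,0)$. We say that $\pi$ preserves $\Phi_A$ if $\Phi_A(\pi(g)x) = \Phi_A(x)$ for all $x\in H$, $g\in G$. (i) If $\pi$ preserves a form $\Phi_A$ with a finite number of negative squares, where $A$ is an invertible self-adjoint bounded operator, then $\pi$ is similar to a unitary representation: there are an invertible bounded operator $V$ on $H$ with bounded inverse and a unitary representation $U$ of $G$ on $H$ such that $\pi(g) = V^{-1}U(g)V$ for all $g\in G$. (ii) If $\pi$ preserves a form $\Phi(x) = (P_1x,x)-(P_2x,x)$, where $P_1,P_2$ are orthogonal projections on $H$ with $P_1+P_2=1$ and $\dim P_2H<\infty$, then $\pi$ is similar to a unitary representation and its constant of similarity $c(\pi)$, the infimum of $\|V\|\,\|V^{-1}\|$ over all $V$ as in (i), satisfies $$c(\pi)\le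 2\|\pi\|^2+1 .$$ In particular, the bound does not depend on the number $\dim P_2H$ of negative squares. -/

import Mathlib

namespace PontryaginRep

variable {H : Type*} [NormedAddCommGroup H] [InnerProductSpace ℂ H] [CompleteSpace H]
variable {G : Type*} [Group G]

/-- The quadratic form `Φ(x) = (Ax, x)` of an operator `A`; for self-adjoint `A` the number
`(Ax, x)` is real, so taking its real part only changes the type. -/
noncomputable def quadForm (A : H →L[ℂ] H) (x : H) : ℝ :=
  (inner ℂ (A x) x).re

/-- The spectral projection of an invertible self-adjoint operator `A` for the interval `(-∞, 0)`.
The indicator function of `(-∞, 0)` is continuous on the spectrum of `A`, as `0` is not in it,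
so that the continuous functional calculus applies. -/
noncomputable def negSpectralProj (A : H →L[ℂ] H) : H →L[ℂ] H :=
  cfc (fun t : ℝ => if t < 0 then (1 : ℝ) else 0) A

/-- The form of the invertible self-adjoint operator `A` has a finite number of negative squares:
the spectral subspace of `A` for `(-∞, 0)` is finite-dimensional. -/
def FinitelyManyNegativeSquares (A : H →L[ℂ] H) : Prop :=
  FiniteDimensional ℂ (LinearMap.range (negSpectralProj A : H →ₗ[ℂ] H))

/-- `π` preserves the quadratic form of `A`. -/
def PreservesForm (π : G →* (H →L[ℂ] H)) (A : H →L[ℂ] H) : Prop :=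
  ∀ (g : G) (x : H), quadForm A (π g x) = quadForm A x

/-- `π` is bounded: the norms `‖π g‖` are bounded above. -/
def IsBoundedRep (π : G →* (H →L[ℂ] H)) : Prop :=
  BddAbove (Set.range fun g : G => ‖π g‖)

/-- `‖π‖ = sup_g ‖π g‖` (for bounded `π`). -/
noncomputable def repNorm (π : G →* (H →L[ℂ] H)) : ℝ :=
  ⨆ g : G, ‖π g‖

/-- The invertible operator `V` makes `π` unitary: `π g = V⁻¹ U(g) V` for a unitary
representation `U` on the same space. -/
def Unitarizes (V : H ≃L[ℂ] H) (π : G →* (H →L[ℂ] H)) : Prop :=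
  ∃ U : G →* unitary (H →L[ℂ] H), ∀ g : G,
    π g = (V.symm : H →L[ℂ] H) ∘L (U g : H →L[ℂ] H) ∘L (V : H →L[ℂ] H)

/-- `π` is similar to a unitary representation. -/
def IsSimilarToUnitary (π : G →* (H →L[ℂ] H)) : Prop :=
  ∃ V : H ≃L[ℂ] H, Unitarizes V π

/-- The constant of similarity `c(π)`: the infimum of `‖V‖ ‖V⁻¹‖` over all invertible `V` that
make `π` unitary (meaningful when `π` is similar to a unitary representation). -/
noncomputable def similarityConstant (π : G →* (H →L[ℂ] H)) : ℝ :=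
  sInf {c : ℝ | ∃ V : H ≃L[ℂ] H, Unitarizes V π ∧
    c = ‖(V : H →L[ℂ] H)‖ * ‖(V.symm : H →L[ℂ] H)‖}

end PontryaginRep

/-!
The group acts on bounded operators by `S ↦ π(g)* S π(g)`, and a positive invertible fixed point `S`
of this action makes `π` unitary after conjugation with `V = √S`. So the task is to find such an
`S`, between `N⁻²` and `N²` for the estimate, where `N = ‖π‖`.

The operator `A` of the invariant form is itself a fixed point, and when there are finitely many
negative squares, `|A| = A + T` with `T` of finite rank. Hence the orbit of `|A|` is
`A + π(g)* T π(g)`: up to the translation by `A`, it is a bounded orbit of a uniformly bounded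
*linear* representation on the finite-rank operators with the Hilbert–Schmidt inner product. This
is a pre-Hilbert space `E`, here `H ⊗[ℝ] H` (`tensorToOp`, `tensorRep`). On `E` the invariant
function `u ↦ sup_g ‖g u‖²` is uniformly convex, because `‖g u‖` is bounded below by a multiple of
`‖u‖`. Thus its minimizing sequences in the convex hull of the orbit are Cauchy, and, as the
translates of a minimizing sequence are minimizing too, they are asymptotically fixed
(`exists_cauchySeq_tendsto_sub_zero`). The Hilbert–Schmidt norm dominates the operator norm, so the
limit gives a fixed operator `S` in the closed convex hull of the orbit of `|A|`
(`exists_fixed_operator`). Bounds `m ≤ |A| ≤ M` give `m N⁻² ≤ S ≤ M N²`, since these inequalities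
hold on the orbit and define a closed convex set (`boundedForms`). For `A = P₁ - P₂` one has
`|A| = 1`, and the condition number of `√S` is at most `N²`, which is below `2 N² + 1`.
-/

open Filter Topology TensorProduct

namespace PontryaginRep

/-! ### Asymptotically fixed points of bounded representations -/

/-- The convex hull of an orbit of a uniformly bounded representation on a real pre-Hilbert space
contains a Cauchy sequence of asymptotically fixed vectors. It is a minimizing sequence of the
invariant function `x ↦ sup_g ‖ρ g x‖²`, which by the parallelogram law is uniformly convex. -/
theorem exists_cauchySeq_tendsto_sub_zero {E : Type*} [NormedAddCommGroup E]
    [InnerProductSpace ℝ E] {G : Type*} [Group G] (ρ : G →* (E →L[ℝ] E)) {C : ℝ}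
    (hρ : ∀ g, ‖ρ g‖ ≤ C) (v : E) :
    ∃ u : ℕ → E, (∀ n, u n ∈ convexHull ℝ (Set.range fun g => ρ g v)) ∧ CauchySeq u ∧
      ∀ g, Tendsto (fun n => ρ g (u n) - u n) atTop (𝓝 0) := by
  set K := convexHull ℝ (Set.range fun g => ρ g v) with hK
  have hC : 0 ≤ C := (norm_nonneg _).trans (hρ 1)
  have hle (g : G) (x : E) : ‖ρ g x‖ ≤ C * ‖x‖ := (ρ g).le_of_opNorm_le (hρ g) x
  have hmul (g h : G) (x : E) : ρ g (ρ h x) = ρ (g * h) x := by rw [map_mul]; rfl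
  have hge (g : G) (x : E) : ‖x‖ ^ 2 ≤ C ^ 2 * ‖ρ g x‖ ^ 2 := by
    have h : ‖ρ g⁻¹ (ρ g x)‖ ≤ C * ‖ρ g x‖ := hle g⁻¹ (ρ g x)
    have hx : ρ g⁻¹ (ρ g x) = x := by rw [hmul, inv_mul_cancel, map_one]; rfl
    rw [hx] at h
    rw [← mul_pow]
    gcongr
  let f : E → ℝ := fun x => ⨆ g, ‖ρ g x‖ ^ 2
  have hbdd (x : E) : BddAbove (Set.range fun g => ‖ρ g x‖ ^ 2) := by
    refine ⟨(C * ‖x‖) ^ 2, ?_⟩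
    rintro _ ⟨g, rfl⟩
    have := hle g x
    dsimp only
    gcongr
  have hf0 (x : E) : 0 ≤ f x := Real.iSup_nonneg fun g => by positivity
  have hfle (g : G) (x : E) : ‖ρ g x‖ ^ 2 ≤ f x := le_ciSup (hbdd x) g
  have hfinv (g : G) (x : E) : f (ρ g x) ≤ f x :=
    ciSup_le fun h => by rw [hmul]; exact hfle _ x
  have hKinv (g : G) {x : E} (hx : x ∈ K) : ρ g x ∈ K := by
    have h := Set.mem_image_of_mem (ρ g : E →ₗ[ℝ] E) hx
    rw [hK, LinearMap.image_convexHull] at h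
    refine convexHull_mono ?_ h
    rintro _ ⟨_, ⟨k, rfl⟩, rfl⟩
    exact ⟨g * k, (hmul g k v).symm⟩
  have hKne : K.Nonempty := ⟨v, subset_convexHull ℝ _ ⟨1, by simp⟩⟩
  have hbelow : BddBelow (f '' K) := ⟨0, by rintro _ ⟨x, -, rfl⟩; exact hf0 x⟩
  set d := sInf (f '' K)
  have hdle {x : E} (hx : x ∈ K) : d ≤ f x := csInf_le hbelow ⟨x, hx, rfl⟩
  have key {x y : E} (hx : x ∈ K) (hy : y ∈ K) {ε : ℝ} (hε : 0 < ε) (hfx : f x ≤ d + ε)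
      (hfy : f y ≤ d + ε) : ‖x - y‖ ^ 2 ≤ 8 * C ^ 2 * ε := by
    have hmid : (1 / 2 : ℝ) • x + (1 / 2 : ℝ) • y ∈ K :=
      convex_convexHull ℝ _ hx hy (by norm_num) (by norm_num) (by norm_num)
    have hlt : d - ε < f ((1 / 2 : ℝ) • x + (1 / 2 : ℝ) • y) := by linarith [hdle hmid]
    obtain ⟨g, hg⟩ := exists_lt_of_lt_ciSup hlt
    rw [← smul_add, map_smul, norm_smul, mul_pow, map_add] at hg
    have hpar := parallelogram_law_with_norm ℝ (ρ g x) (ρ g y)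
    rw [← map_sub] at hpar
    have h1 := hge g (x - y)
    have h2 := (hfle g x).trans hfx
    have h3 := (hfle g y).trans hfy
    norm_num at hg
    have h4 : ‖ρ g (x - y)‖ ^ 2 ≤ 8 * ε := by nlinarith
    nlinarith [mul_le_mul_of_nonneg_left h4 (sq_nonneg C)]
  have hseq (n : ℕ) : ∃ x ∈ K, f x ≤ d + 1 / ((n : ℝ) + 1) := by
    obtain ⟨_, ⟨x, hx, rfl⟩, h⟩ := exists_lt_of_csInf_lt (hKne.image f)
      (show sInf (f '' K) < d + 1 / ((n : ℝ) + 1) by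
        have : 0 < 1 / ((n : ℝ) + 1) := by positivity
        linarith)
    exact ⟨x, hx, h.le⟩
  choose u huK hfu using hseq
  have hlim : Tendsto (fun n : ℕ => √(8 * C ^ 2 * (1 / ((n : ℝ) + 1)))) atTop (𝓝 0) := by
    have := (tendsto_one_div_add_atTop_nhds_zero_nat (𝕜 := ℝ)).const_mul (8 * C ^ 2)
    simpa [Function.comp_def] using (Real.continuous_sqrt.tendsto _).comp this
  refine ⟨u, huK, cauchySeq_of_le_tendsto_0 _ (fun n m N hn hm => ?_) hlim, fun g => ?_⟩
  · have hmono {k : ℕ} (hk : N ≤ k) : f (u k) ≤ d + 1 / ((N : ℝ) + 1) :=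
      (hfu k).trans (by gcongr)
    rw [dist_eq_norm]
    exact Real.le_sqrt_of_sq_le (key (huK n) (huK m) (by positivity) (hmono hn) (hmono hm))
  · refine squeeze_zero_norm (fun n => ?_) hlim
    exact Real.le_sqrt_of_sq_le
      (key (hKinv g (huK n)) (huK n) (by positivity) ((hfinv g _).trans (hfu n)) (hfu n))

/-! ### Finite-rank operators as real tensors -/

section RealTensor

-- The real inner product of `H ⊗[ℝ] H` comes from `re ⟪x, y⟫`, which is not a global instance.
attribute [local instance] InnerProductSpace.complexToReal

variable {H : Type*} [NormedAddCommGroup H] [InnerProductSpace ℂ H]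

/-- The map `v ⊗ w ↦ ⟪w, ·⟫ v` from the tensor square of `H` to the bounded operators. The tensor
product is over `ℝ`, since `⟪w, ·⟫ v` is antilinear in `w`. Its inner product replaces the
Hilbert–Schmidt one. -/
noncomputable def tensorToOp : H ⊗[ℝ] H →ₗ[ℝ] H →L[ℂ] H :=
  TensorProduct.lift (LinearMap.mk₂ ℝ (fun v w => InnerProductSpace.rankOne ℂ v w)
    (by simp) (by simp) (by simp) (by intro c v w; ext z; simp [← Complex.coe_smul]))

@[simp] theorem tensorToOp_tmul (v w : H) :
    tensorToOp (v ⊗ₜ w) = InnerProductSpace.rankOne ℂ v w := rfl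

/-- The operator `a ⊗ a` on the real tensor square of `H`. -/
noncomputable def tensorSq (a : H →L[ℂ] H) : H ⊗[ℝ] H →L[ℝ] H ⊗[ℝ] H :=
  TensorProduct.mapL (a.restrictScalars ℝ) (a.restrictScalars ℝ)

theorem tensorSq_one : tensorSq (1 : H →L[ℂ] H) = 1 :=
  TensorProduct.mapL_id_id

theorem tensorSq_mul (a b : H →L[ℂ] H) : tensorSq (a * b) = tensorSq a * tensorSq b :=
  TensorProduct.mapL_mul (a.restrictScalars ℝ) (b.restrictScalars ℝ)
    (a.restrictScalars ℝ) (b.restrictScalars ℝ)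

theorem norm_tensorSq_le (a : H →L[ℂ] H) : ‖tensorSq a‖ ≤ ‖a‖ ^ 2 := by
  have h := TensorProduct.norm_mapL_le (a.restrictScalars ℝ) (a.restrictScalars ℝ)
  rwa [ContinuousLinearMap.norm_restrictScalars, ← sq] at h

theorem re_inner_tensorToOp (u : H ⊗[ℝ] H) (x y : H) :
    (inner ℂ (tensorToOp u x) y).re =
      inner ℝ u (y ⊗ₜ[ℝ] x + (Complex.I • y) ⊗ₜ[ℝ] (Complex.I • x)) := by
  induction u using TensorProduct.induction_on with
  | zero => simp
  | tmul v w =>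
    have h (a b : H) : inner ℝ a b = (inner ℂ a b).re := rfl
    have hre : (inner ℂ x w).re = (inner ℂ w x).re := by rw [← inner_conj_symm, Complex.conj_re]
    have him : (inner ℂ x w).im = -(inner ℂ w x).im := by rw [← inner_conj_symm, Complex.conj_im]
    simp [inner_add_right, h, hre, him]
  | add u v hu hv => simp [inner_add_left, hu, hv]

theorem norm_tensorToOp_le (u : H ⊗[ℝ] H) : ‖tensorToOp u‖ ≤ 2 * ‖u‖ := by
  refine ContinuousLinearMap.opNorm_le_bound _ (by positivity) fun x => ?_
  rcases (norm_nonneg (tensorToOp u x)).eq_or_lt with hx | hx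
  · rw [← hx]
    positivity
  have h := re_inner_tensorToOp u x (tensorToOp u x)
  rw [← RCLike.re_eq_complex_re, inner_self_eq_norm_sq] at h
  have h2 := real_inner_le_norm u
    (tensorToOp u x ⊗ₜ[ℝ] x + (Complex.I • tensorToOp u x) ⊗ₜ[ℝ] (Complex.I • x))
  have h3 := norm_add_le (tensorToOp u x ⊗ₜ[ℝ] x)
    ((Complex.I • tensorToOp u x) ⊗ₜ[ℝ] (Complex.I • x))
  simp only [TensorProduct.norm_tmul, norm_smul, Complex.norm_I, one_mul] at h3
  have h4 := mul_le_mul_of_nonneg_left h3 (norm_nonneg u)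
  nlinarith

variable [CompleteSpace H]

theorem tensorToOp_tensorSq (a : H →L[ℂ] H) (u : H ⊗[ℝ] H) :
    tensorToOp (tensorSq a u) = a * tensorToOp u * star a := by
  induction u using TensorProduct.induction_on with
  | zero => simp
  | tmul v w =>
    ext z
    simp [tensorSq, ContinuousLinearMap.star_eq_adjoint, ContinuousLinearMap.adjoint_inner_right]
  | add u v hu hv => simp [hu, hv, mul_add, add_mul]

theorem exists_tensorToOp_eq (T : H →L[ℂ] H)
    (hT : FiniteDimensional ℂ (LinearMap.range (T : H →ₗ[ℂ] H))) :
    ∃ u : H ⊗[ℝ] H, tensorToOp u = T := by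
  let b := stdOrthonormalBasis ℂ (LinearMap.range (T : H →ₗ[ℂ] H))
  refine ⟨∑ i, (b i : H) ⊗ₜ[ℝ] T.adjoint (b i), ?_⟩
  ext x
  have := congrArg Subtype.val (b.sum_repr' ⟨T x, x, rfl⟩)
  simp only [map_sum, tensorToOp_tmul, sum_apply, InnerProductSpace.rankOne_apply,
    ContinuousLinearMap.adjoint_inner_left]
  simpa using this

variable {G : Type*} [Group G]

/-- The representation `g ↦ π(g⁻¹)* ⊗ π(g⁻¹)*`; under `tensorToOp` it becomes the action
`T ↦ π(g⁻¹)* T π(g⁻¹)` on operators. -/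
noncomputable def tensorRep (π : G →* (H →L[ℂ] H)) : G →* (H ⊗[ℝ] H →L[ℝ] H ⊗[ℝ] H) where
  toFun g := tensorSq (star (π g⁻¹))
  map_one' := by simp [tensorSq_one]
  map_mul' g h := by rw [mul_inv_rev, map_mul, star_mul, tensorSq_mul]

theorem tensorToOp_tensorRep (π : G →* (H →L[ℂ] H)) (g : G) (u : H ⊗[ℝ] H) :
    tensorToOp (tensorRep π g u) = star (π g⁻¹) * tensorToOp u * π g⁻¹ := by
  simp [tensorRep, tensorToOp_tensorSq]

/-- If the bounded representation `π` fixes `A` and `T` has finite rank, then `π` fixes a point of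
every closed convex set which contains the orbit of `A + T`; here `g` acts on operators by
`S ↦ π(g)* S π(g)`. The orbit is `A` plus a bounded orbit of finite-rank operators. -/
theorem exists_fixed_operator (π : G →* (H →L[ℂ] H)) {N : ℝ} (hN : ∀ g, ‖π g‖ ≤ N)
    {A T : H →L[ℂ] H} (hA : ∀ g, star (π g) * A * π g = A)
    (hT : FiniteDimensional ℂ (LinearMap.range (T : H →ₗ[ℂ] H)))
    {Q : Set (H →L[ℂ] H)} (hQ : Convex ℝ Q) (hQc : IsClosed Q)
    (horb : ∀ g, star (π g) * (A + T) * π g ∈ Q) :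
    ∃ S ∈ Q, ∀ g, star (π g) * S * π g = S := by
  obtain ⟨v, rfl⟩ := exists_tensorToOp_eq T hT
  obtain ⟨u, huK, hu, hfix⟩ := exists_cauchySeq_tendsto_sub_zero (tensorRep π) (C := N ^ 2)
    (fun g => (norm_tensorSq_le _).trans (by rw [norm_star]; gcongr; exact hN _)) v
  let Φ : H ⊗[ℝ] H →L[ℝ] H →L[ℂ] H := tensorToOp.mkContinuous 2 norm_tensorToOp_le
  have hΦ (w : H ⊗[ℝ] H) : Φ w = tensorToOp w := rfl
  obtain ⟨L, hL⟩ := cauchySeq_tendsto_of_complete (Φ.uniformContinuous.comp_cauchySeq hu)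
  refine ⟨A + L, hQc.mem_of_tendsto (hL.const_add A) (Eventually.of_forall fun n => ?_),
    fun g => ?_⟩
  · have hsub : convexHull ℝ (Set.range fun g => tensorRep π g v) ⊆ {w | A + Φ w ∈ Q} := by
      refine convexHull_min ?_ fun x hx y hy a b ha hb hab => ?_
      · rintro _ ⟨g, rfl⟩
        have := horb g⁻¹
        rw [mul_add, add_mul, hA] at this
        simpa only [Set.mem_ofPred_eq, hΦ, tensorToOp_tensorRep] using this
      · have := hQ hx hy ha hb hab
        rw [smul_add, smul_add, add_add_add_comm, ← add_smul, hab, one_smul] at this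
        simpa only [Set.mem_ofPred_eq, map_add, map_smul] using this
    exact hsub (huK n)
  · have h1 : Tendsto (fun n => star (π g) * Φ (u n) * π g - Φ (u n)) atTop
        (𝓝 (star (π g) * L * π g - L)) := ((hL.const_mul _).mul_const _).sub hL
    have h2 : Tendsto (fun n => star (π g) * Φ (u n) * π g - Φ (u n)) atTop (𝓝 0) := by
      have := (Φ.continuous.tendsto 0).comp (hfix g⁻¹)
      simpa [Function.comp_def, hΦ, tensorToOp_tensorRep] using this
    rw [mul_add, add_mul, hA, sub_eq_zero.mp (tendsto_nhds_unique h1 h2)]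

end RealTensor

/-! ### Invariant positive operators and unitarizability -/

variable {H : Type*} [NormedAddCommGroup H] [InnerProductSpace ℂ H] [CompleteSpace H]
variable {G : Type*} [Group G]

theorem star_mul_mul_eq_of_quadForm {A a : H →L[ℂ] H} (hA : IsSelfAdjoint A)
    (h : ∀ x, quadForm A (a x) = quadForm A x) : star a * A * a = A := by
  have hreal (B : H →L[ℂ] H) (hB : IsSelfAdjoint B) (x : H) :
      inner ℂ (B x) x = (quadForm B x : ℂ) :=
    ((ContinuousLinearMap.isSelfAdjoint_iff_isSymmetric.mp hB).coe_re_inner_apply_self x).symm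
  refine ContinuousLinearMap.coe_inj.mp ((ext_inner_map _ _).mp fun x => ?_)
  have h1 : inner ℂ ((star a * A * a) x) x = inner ℂ (A (a x)) (a x) := by
    simp [ContinuousLinearMap.star_eq_adjoint, ContinuousLinearMap.adjoint_inner_left]
  exact h1.trans (by rw [hreal A hA, h x]; exact (hreal A hA x).symm)

/-- The self-adjoint operators `S` with `a⁻² ≤ S ≤ b²`; for `a = 0` these inequalities force
`H = 0`. -/
def boundedForms (a b : ℝ) : Set (H →L[ℂ] H) :=
  {S | IsSelfAdjoint S ∧ ∀ x, ‖x‖ ^ 2 ≤ a ^ 2 * quadForm S x ∧ quadForm S x ≤ b ^ 2 * ‖x‖ ^ 2}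

theorem convex_boundedForms (a b : ℝ) : Convex ℝ (boundedForms a b : Set (H →L[ℂ] H)) := by
  rintro S ⟨hS, hS'⟩ T ⟨hT, hT'⟩ s t hs ht hst
  have hq (x : H) : quadForm (s • S + t • T) x = s * quadForm S x + t * quadForm T x := by
    simp [quadForm, ← Complex.coe_smul, mul_comm]
  refine ⟨((IsSelfAdjoint.all s).smul hS).add ((IsSelfAdjoint.all t).smul hT), fun x => ?_⟩
  rw [hq]
  obtain rfl : t = 1 - s := by linarith
  have h1 := hS' x
  have h2 := hT' x
  constructor
  · nlinarith [mul_le_mul_of_nonneg_left h1.1 hs, mul_le_mul_of_nonneg_left h2.1 ht]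
  · nlinarith [mul_le_mul_of_nonneg_left h1.2 hs, mul_le_mul_of_nonneg_left h2.2 ht]

theorem isClosed_boundedForms (a b : ℝ) : IsClosed (boundedForms a b : Set (H →L[ℂ] H)) := by
  have hq (x : H) : Continuous fun S : H →L[ℂ] H => quadForm S x := by
    unfold quadForm
    fun_prop
  simp only [boundedForms, Set.ofPred_and, Set.ofPred_forall]
  exact (isClosed_eq continuous_star continuous_id).inter (isClosed_iInter fun x =>
    (isClosed_le continuous_const (continuous_const.mul (hq x))).inter
      (isClosed_le (hq x) continuous_const))

theorem conj_mem_boundedForms {a b N : ℝ} {S c d : H →L[ℂ] H} (hS : S ∈ boundedForms a b)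
    (hdc : d * c = 1) (hc : ‖c‖ ≤ N) (hd : ‖d‖ ≤ N) :
    star c * S * c ∈ boundedForms (a * N) (b * N) := by
  refine ⟨hS.1.conjugate' c, fun x => ?_⟩
  have hq : quadForm (star c * S * c) x = quadForm S (c x) := by
    simp [quadForm, ContinuousLinearMap.star_eq_adjoint, ContinuousLinearMap.adjoint_inner_left]
  have h1 : ‖c x‖ ≤ N * ‖x‖ := c.le_of_opNorm_le hc x
  have h2 : ‖x‖ ≤ N * ‖c x‖ := by
    have hx : d (c x) = x := congrArg (fun e : H →L[ℂ] H => e x) hdc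
    simpa only [hx] using d.le_of_opNorm_le hd (c x)
  rw [hq]
  constructor
  · calc ‖x‖ ^ 2 ≤ (N * ‖c x‖) ^ 2 := by gcongr
      _ = N ^ 2 * ‖c x‖ ^ 2 := by ring
      _ ≤ N ^ 2 * (a ^ 2 * quadForm S (c x)) := by gcongr; exact (hS.2 (c x)).1
      _ = (a * N) ^ 2 * quadForm S (c x) := by ring
  · calc quadForm S (c x) ≤ b ^ 2 * ‖c x‖ ^ 2 := (hS.2 (c x)).2
      _ ≤ b ^ 2 * (N * ‖x‖) ^ 2 := by gcongr
      _ = (b * N) ^ 2 * ‖x‖ ^ 2 := by ring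

/-- The square root of an invariant positive operator makes the representation unitary. -/
theorem exists_unitarizes_of_fixed (π : G →* (H →L[ℂ] H)) {a b : ℝ} (ha : 0 ≤ a) (hb : 0 ≤ b)
    {S : H →L[ℂ] H} (hS : S ∈ boundedForms a b) (hfix : ∀ g, star (π g) * S * π g = S) :
    ∃ V : H ≃L[ℂ] H, Unitarizes V π ∧
      ‖(V : H →L[ℂ] H)‖ * ‖(V.symm : H →L[ℂ] H)‖ ≤ a * b := by
  have hnn (x : H) : 0 ≤ quadForm S x := by
    by_contra! h
    have h1 := (hS.2 x).1
    have h2 : ‖x‖ ^ 2 = 0 := le_antisymm (by nlinarith [sq_nonneg a]) (sq_nonneg _)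
    simp [quadForm, norm_eq_zero.mp (pow_eq_zero_iff two_ne_zero |>.mp h2)] at h
  have hpos : 0 ≤ S := by
    rw [ContinuousLinearMap.nonneg_iff_isPositive, ContinuousLinearMap.isPositive_def]
    exact ⟨ContinuousLinearMap.isSelfAdjoint_iff_isSymmetric.mp hS.1, hnn⟩
  have hunit : IsUnit S := by
    refine S.isUnit_of_forall_le_norm_inner_map (c := ((a ^ 2 + 1)⁻¹).toNNReal)
      (Real.toNNReal_pos.mpr (by positivity)) fun x => ?_
    have h1 := (hS.2 x).1
    have h2 : quadForm S x ≤ ‖inner ℂ (S x) x‖ := Complex.re_le_norm _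
    rw [Real.coe_toNNReal _ (by positivity), ← div_eq_mul_inv, div_le_iff₀ (by positivity)]
    nlinarith [hnn x, sq_nonneg a]
  set R := CFC.sqrt S
  have hRR : R * R = S := CFC.sqrt_mul_sqrt_self S hpos
  have hRsa : star R = R := (CFC.sqrt_nonneg S).isSelfAdjoint
  have hRnorm (x : H) : ‖R x‖ ^ 2 = quadForm S x := by
    rw [← hRR, quadForm, mul_apply_eq_comp]
    nth_rw 2 [← hRsa]
    rw [ContinuousLinearMap.star_eq_adjoint, ContinuousLinearMap.adjoint_inner_left]
    exact (inner_self_eq_norm_sq (𝕜 := ℂ) (R x)).symm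
  obtain ⟨r, hr⟩ := (CFC.isUnit_sqrt_iff S hpos).mpr hunit
  have hrR : (r : H →L[ℂ] H) = R := hr
  have hsr : (↑r⁻¹ : H →L[ℂ] H) * R = 1 := by rw [← hrR]; exact r.inv_mul
  have hrs : R * (↑r⁻¹ : H →L[ℂ] H) = 1 := by rw [← hrR]; exact r.mul_inv
  set s : H →L[ℂ] H := ↑r⁻¹
  have hss : star s * S * s = 1 := by
    rw [← hRR, ← hRsa, ← mul_assoc, ← star_mul, hRsa, mul_assoc, hrs, star_one, one_mul]
  let U₀ : G →* (H →L[ℂ] H) :=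
    { toFun := fun g => R * π g * s
      map_one' := by rw [map_one, mul_one, hrs]
      map_mul' := fun g h => by
        calc R * π (g * h) * s = R * π g * 1 * π h * s := by rw [map_mul]; noncomm_ring
          _ = R * π g * s * (R * π h * s) := by rw [← hsr]; noncomm_ring }
  have hiso (g : G) : star (U₀ g) * U₀ g = 1 := by
    calc star (R * π g * s) * (R * π g * s)
        = star s * (star (π g) * (star R * R) * π g) * s := by
          rw [star_mul, star_mul]; noncomm_ring
      _ = 1 := by rw [hRsa, hRR, hfix, hss]
  have hinv (g : G) : U₀ g * U₀ g⁻¹ = 1 := by rw [← map_mul, mul_inv_cancel, map_one]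
  have hU (g : G) : U₀ g ∈ unitary (H →L[ℂ] H) := by
    refine Unitary.mem_iff.mpr ⟨hiso g, ?_⟩
    rw [left_inv_eq_right_inv (hiso g) (hinv g)]
    exact hinv g
  let V : H ≃L[ℂ] H := ContinuousLinearEquiv.ofUnit r
  have hV : (V : H →L[ℂ] H) = R := hr
  have hVs : (V.symm : H →L[ℂ] H) = s := rfl
  refine ⟨V, ⟨U₀.codRestrict _ hU, fun g => ?_⟩, ?_⟩
  · rw [hV, hVs]
    change π g = s * ((R * π g * s) * R)
    calc π g = (s * R) * π g * (s * R) := by rw [hsr, one_mul, mul_one]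
      _ = s * ((R * π g * s) * R) := by noncomm_ring
  · rw [hV, hVs, mul_comm]
    refine mul_le_mul ?_ ?_ (norm_nonneg _) ha
    · refine ContinuousLinearMap.opNorm_le_bound _ ha fun x => ?_
      have hx : R (s x) = x := congrArg (fun e : H →L[ℂ] H => e x) hrs
      have := (hS.2 (s x)).1
      rw [← hRnorm, hx, ← mul_pow] at this
      exact le_of_sq_le_sq this (by positivity)
    · refine ContinuousLinearMap.opNorm_le_bound _ hb fun x => ?_
      have := (hS.2 x).2
      rw [← hRnorm, ← mul_pow] at this
      exact le_of_sq_le_sq this (by positivity)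

/-- A bounded representation preserving the form of `A` is similar to a unitary one as soon as
some finite-rank perturbation of `A` is positive and invertible. -/
theorem exists_unitarizes_of_preservesForm (π : G →* (H →L[ℂ] H)) {N : ℝ}
    (hN : ∀ g, ‖π g‖ ≤ N) {A T : H →L[ℂ] H} (hA : IsSelfAdjoint A) (hπA : PreservesForm π A)
    (hT : FiniteDimensional ℂ (LinearMap.range (T : H →ₗ[ℂ] H))) {a b : ℝ} (ha : 0 ≤ a)
    (hb : 0 ≤ b) (hAT : A + T ∈ boundedForms a b) :
    ∃ V : H ≃L[ℂ] H, Unitarizes V π ∧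
      ‖(V : H →L[ℂ] H)‖ * ‖(V.symm : H →L[ℂ] H)‖ ≤ (a * N) * (b * N) := by
  have hN0 : 0 ≤ N := (norm_nonneg _).trans (hN 1)
  obtain ⟨S, hS, hfix⟩ := exists_fixed_operator π hN
    (fun g => star_mul_mul_eq_of_quadForm hA (hπA g)) hT
    (convex_boundedForms (a * N) (b * N)) (isClosed_boundedForms _ _) fun g =>
      conj_mem_boundedForms hAT (d := π g⁻¹) (by rw [← map_mul, inv_mul_cancel, map_one])
        (hN g) (hN g⁻¹)
  exact exists_unitarizes_of_fixed π (by positivity) (by positivity) hS hfix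

/-! ### Forms with finitely many negative squares -/

/-- Subtracting twice the compression of `A` to its negative spectral subspace gives `|A|`, which
is positive and invertible. -/
theorem exists_sub_negSpectralProj_mem_boundedForms {A : H →L[ℂ] H} (hA : IsSelfAdjoint A)
    (hu : IsUnit A) : ∃ a b : ℝ, 0 ≤ a ∧ 0 ≤ b ∧
      A + (-2 : ℝ) • (A * negSpectralProj A) ∈ boundedForms a b := by
  have h0 (t : ℝ) (ht : t ∈ spectrum ℝ A) : t ≠ 0 := by
    rintro rfl
    exact (spectrum.zero_notMem_iff ℝ).mpr hu ht
  have hcont : ContinuousOn (fun t : ℝ => if t < 0 then (1 : ℝ) else 0) (spectrum ℝ A) := by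
    intro t ht
    refine ContinuousAt.continuousWithinAt ?_
    rcases (h0 t ht).lt_or_gt with h | h
    · refine (continuousAt_const (y := (1 : ℝ))).congr ?_
      filter_upwards [Iio_mem_nhds h] with x hx
      exact (if_pos hx).symm
    · refine (continuousAt_const (y := (0 : ℝ))).congr ?_
      filter_upwards [Ioi_mem_nhds h] with x hx
      exact (if_neg (not_lt.mpr (le_of_lt hx))).symm
  have habs : A + (-2 : ℝ) • (A * negSpectralProj A) = cfc (fun t : ℝ => |t|) A := by
    have hid : ContinuousOn (fun t : ℝ => t) (spectrum ℝ A) := continuousOn_id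
    have e1 : A * negSpectralProj A =
        cfc (fun t : ℝ => t * if t < 0 then (1 : ℝ) else 0) A := by
      rw [cfc_mul _ _ A hid hcont, cfc_id' ℝ A]
      rfl
    have hprod : ContinuousOn (fun t : ℝ => t * if t < 0 then (1 : ℝ) else 0) (spectrum ℝ A) :=
      hid.mul hcont
    have hprod' : ContinuousOn (fun t : ℝ => (-2 : ℝ) • (t * if t < 0 then (1 : ℝ) else 0))
        (spectrum ℝ A) := hprod.const_smul (-2 : ℝ)
    rw [e1, ← cfc_smul (-2 : ℝ) _ A hprod]
    nth_rw 1 [← cfc_id' ℝ A]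
    rw [← cfc_add A _ _ hid hprod']
    refine cfc_congr fun t ht => ?_
    rcases (h0 t ht).lt_or_gt with h | h
    · simp only [if_pos h, abs_of_neg h, smul_eq_mul]
      ring
    · simp [not_lt.mpr h.le, abs_of_pos h]
  rw [habs]
  obtain ⟨m, hm, hmle⟩ : ∃ m : ℝ, 0 < m ∧ ∀ t ∈ spectrum ℝ A, m ≤ |t| := by
    have hnhds : (spectrum ℝ A)ᶜ ∈ 𝓝 (0 : ℝ) :=
      (spectrum.isClosed (𝕜 := ℝ) A).isOpen_compl.mem_nhds fun h => h0 0 h rfl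
    obtain ⟨m, hm, hball⟩ := Metric.mem_nhds_iff.mp hnhds
    refine ⟨m, hm, fun t ht => ?_⟩
    by_contra! h
    exact hball (by simpa using h) ht
  have hlow := algebraMap_le_cfc (fun t : ℝ => |t|) m A hmle
  set S := cfc (fun t : ℝ => |t|) A
  refine ⟨√m⁻¹, √‖S‖, by positivity, by positivity, cfc_predicate _ A, fun x => ⟨?_, ?_⟩⟩
  · have h := ((ContinuousLinearMap.le_def _ _).mp hlow).re_inner_nonneg_left x
    have h' : m * ‖x‖ ^ 2 ≤ quadForm S x := by
      have e : (inner ℂ (m • x) x).re = m * ‖x‖ ^ 2 := by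
        rw [← Complex.coe_smul, inner_smul_left, Complex.conj_ofReal, Complex.re_ofReal_mul]
        congr 1
        exact inner_self_eq_norm_sq (𝕜 := ℂ) x
      simp only [Algebra.algebraMap_eq_smul_one, sub_apply, smul_apply, one_apply_eq_self,
        inner_sub_left, map_sub, RCLike.re_eq_complex_re, e] at h
      exact sub_nonneg.mp h
    rw [Real.sq_sqrt (by positivity), inv_mul_eq_div, le_div_iff₀ hm]
    linarith
  · rw [Real.sq_sqrt (norm_nonneg _)]
    calc quadForm S x ≤ ‖S x‖ * ‖x‖ := re_inner_le_norm (𝕜 := ℂ) (S x) x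
      _ ≤ ‖S‖ * ‖x‖ * ‖x‖ := by gcongr; exact S.le_opNorm x
      _ = ‖S‖ * ‖x‖ ^ 2 := by ring

end PontryaginRep

theorem theorem4p1 {G : Type*} [Group G]
    {H : Type*} [NormedAddCommGroup H] [InnerProductSpace ℂ H] [CompleteSpace H]
    (π : G →* (H →L[ℂ] H)) (hπ : PontryaginRep.IsBoundedRep π) :
    -- similarity, for the form of any invertible self-adjoint operator
    (∀ A : H →L[ℂ] H, IsSelfAdjoint A → IsUnit A →
      PontryaginRep.FinitelyManyNegativeSquares A → PontryaginRep.PreservesForm π A →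
      PontryaginRep.IsSimilarToUnitary π) ∧
    -- similarity with the estimate, for the form `(P₁x, x) - (P₂x, x)`
    (∀ P₁ P₂ : H →L[ℂ] H, IsStarProjection P₁ → IsStarProjection P₂ → P₁ + P₂ = 1 →
      FiniteDimensional ℂ (LinearMap.range (P₂ : H →ₗ[ℂ] H)) →
      PontryaginRep.PreservesForm π (P₁ - P₂) →
      PontryaginRep.IsSimilarToUnitary π ∧
        PontryaginRep.similarityConstant π ≤ 2 * PontryaginRep.repNorm π ^ 2 + 1) := by
  have hN (g : G) : ‖π g‖ ≤ PontryaginRep.repNorm π := le_ciSup hπ g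
  refine ⟨fun A hA hu hfin hpres => ?_, fun P₁ P₂ h₁ h₂ hsum hfin hpres => ?_⟩
  · obtain ⟨a, b, ha, hb, hab⟩ :=
      PontryaginRep.exists_sub_negSpectralProj_mem_boundedForms hA hu
    have hT : FiniteDimensional ℂ (LinearMap.range
        (((-2 : ℝ) • (A * PontryaginRep.negSpectralProj A) : H →L[ℂ] H) : H →ₗ[ℂ] H)) := by
      have : FiniteDimensional ℂ
          (LinearMap.range (PontryaginRep.negSpectralProj A : H →ₗ[ℂ] H)) := hfin
      let B : H →ₗ[ℂ] H := (((-2 : ℝ) • A : H →L[ℂ] H) : H →ₗ[ℂ] H)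
      refine Submodule.finiteDimensional_of_le
        (S₂ := (LinearMap.range (PontryaginRep.negSpectralProj A : H →ₗ[ℂ] H)).map B) ?_
      rintro _ ⟨x, rfl⟩
      exact ⟨_, ⟨x, rfl⟩, rfl⟩
    obtain ⟨V, hV, -⟩ :=
      PontryaginRep.exists_unitarizes_of_preservesForm π hN hA hpres hT ha hb hab
    exact ⟨V, hV⟩
  · have hT : FiniteDimensional ℂ
        (LinearMap.range (((2 : ℝ) • P₂ : H →L[ℂ] H) : H →ₗ[ℂ] H)) := by
      refine Submodule.finiteDimensional_of_le (S₂ := LinearMap.range (P₂ : H →ₗ[ℂ] H)) ?_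
      rintro _ ⟨x, rfl⟩
      exact ⟨(2 : ℝ) • x, P₂.map_smul_of_tower (2 : ℝ) x⟩
    have hone : P₁ - P₂ + (2 : ℝ) • P₂ ∈ PontryaginRep.boundedForms (H := H) 1 1 := by
      have : P₁ - P₂ + (2 : ℝ) • P₂ = 1 := by rw [← hsum, two_smul]; abel
      rw [this]
      refine ⟨.one _, fun x => ?_⟩
      have : PontryaginRep.quadForm (1 : H →L[ℂ] H) x = ‖x‖ ^ 2 :=
        inner_self_eq_norm_sq (𝕜 := ℂ) x
      simp [this]
    obtain ⟨V, hV, hle⟩ := PontryaginRep.exists_unitarizes_of_preservesForm π hN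
      (h₁.isSelfAdjoint.sub h₂.isSelfAdjoint) hpres hT zero_le_one zero_le_one hone
    refine ⟨⟨V, hV⟩, ?_⟩
    have hbelow : BddBelow {c : ℝ | ∃ V : H ≃L[ℂ] H, PontryaginRep.Unitarizes V π ∧
        c = ‖(V : H →L[ℂ] H)‖ * ‖(V.symm : H →L[ℂ] H)‖} :=
      ⟨0, by rintro _ ⟨V, -, rfl⟩; positivity⟩
    have h : PontryaginRep.similarityConstant π ≤ _ := csInf_le hbelow ⟨V, hV, rfl⟩
    -- the square root of the fixed operator has condition number at most `‖π‖ ^ 2`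
    nlinarith [sq_nonneg (PontryaginRep.repNorm π)]
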